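/- Let $V$ be a finite set. A hypergraph on $V$ is a nonempty family $\mathcal H$ of nonempty subsets of $V$ (hyperedges) with $\bigcup_{H\in\mathcal H}H=V$. A set $T\subseteq V$ is a transversal of a family $\mathcal F\subseteq 2^V$ if $T\cap F\neq\emptyset$ for all $F\in\mathcal F$; the family is transversal-free if none of its members is a transversal of it. $\mathcal H$ is minimal transversal-free if it is transversal-free but for every proper subset $S\subsetneq V$ for which $\mathcal H_S=\{H\in\mathcal H: H\subseteq S\}$ is nonempty, $\mathcal H_S$ is not transversal-free. $\mathcal H$ is a matroid hypergraph if it is the family of bases of a matroid on $V$. In the game $NIM_{\mathcal H}$ the positions are $x\in\mathbb Z_{\ge 0}^V$, and a move $x\to x'$ chooses $H\in\mathcal H$ and strictly decreases exactly the coordinates $x_i$, $i\in H$. Its Sprague–Grundy function is $\mathcal G_{\mathcal H}(x)=\operatorname{mex}\{\mathcal G_{\mathcal H}(x'): x\to x'\}$. The height $h_{\mathcal H}(x)$ is the maximum number of consecutive moves starting from $x$. With $e=(1,\dots,1)$ put $m(x)=\min_{i\in V}x_i$, $y(x)=h_{\mathcal H}(x-m(x)e)+1$, and $$f_{\mathcal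 H}(x)=\begin{cases}h_{\mathcal H}(x)&\text{if } m(x)\le\binom{y(x)}2,\\[2pt] \binom{y(x)}2+\Bigl(\bigl(m(x)-\binom{y(x)}2-1\bigr)\bmod y(x)\Bigr)&\text{otherwise.}\end{cases}$$ $\mathcal H$ is a JM hypergraph if $\mathcal G_{\mathcal H}(x)=f_{\mathcal H}(x)$ for all $x\in\mathbb Z_{\ge0}^V$. **Theorem.** Let $k,\delta$ be integers with $0<\delta\le k-3$, let $|V|=2k+\delta$, and let $\mathcal K$ be a family of $(k+\delta-1)$-element subsets of $V$ such that - (K1) $|K\cap K'|\ge\delta$ for all $K,K'\in\mathcal K$; - (K2) $|K\cap K'|\le k-2$ for all distinct $K,K'\in\mathcal K$; - (K3) no singleton $\{v\}$, $v\in V$, is a transversal of $\mathcal K$. Let $\mathcal H$ be the family of all $k$-element subsets of $V$ that are not contained in any member of $\mathcal K$. Then $\mathcal H$ is a hypergraph on $V$, it is a matroid hypergraph, it is minimal transversal-free, and it is a JM hypergraph. -/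

import Mathlib

namespace HypergraphNim

variable {V : Type*} [Fintype V] [DecidableEq V]

/-- The standing requirements on a hypergraph with vertex set `V`: it has a hyperedge, the empty
set is not a hyperedge, and every vertex lies in some hyperedge. -/
structure IsHypergraph (H : Finset (Finset V)) : Prop where
  nonempty : H.Nonempty
  empty_notMem : ∅ ∉ H
  covers : ∀ v : V, ∃ E ∈ H, v ∈ E

/-- `H` is `r`-uniform: all its hyperedges have exactly `r` elements. -/
def IsUniform (r : ℕ) (H : Finset (Finset V)) : Prop := ∀ E ∈ H, E.card = r

/-- `T` is a transversal of `H`: it meets every hyperedge. -/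
def IsTransversal (H : Finset (Finset V)) (T : Finset V) : Prop := ∀ E ∈ H, (T ∩ E).Nonempty

/-- No hyperedge of `H` is a transversal of `H`. -/
def IsTransversalFree (H : Finset (Finset V)) : Prop := ∀ E ∈ H, ¬ IsTransversal H E

/-- The subhypergraph induced by `S`: all hyperedges contained in `S`. -/
def induced (H : Finset (Finset V)) (S : Finset V) : Finset (Finset V) := {E ∈ H | E ⊆ S}

/-- `H` is transversal-free, but no nonempty induced subhypergraph on a proper subset of the
vertices is. -/
def IsMinimalTransversalFree (H : Finset (Finset V)) : Prop :=
  IsTransversalFree H ∧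
    ∀ S : Finset V, S ≠ Finset.univ → (induced H S).Nonempty → ¬ IsTransversalFree (induced H S)

/-- `H` is the family of bases of a matroid with ground set `V`. -/
def IsMatroidHypergraph (H : Finset (Finset V)) : Prop :=
  ∃ M : Matroid V, M.E = Set.univ ∧ ∀ B : Finset V, M.IsBase (B : Set V) ↔ B ∈ H

/-- `x → y` is a move of the game `NIM_H`: piles only decrease, at least one of them does, and the
set of strictly decreased piles is a hyperedge of `H`. -/
def Move (H : Finset (Finset V)) (x y : V → ℕ) : Prop :=
  y < x ∧ ({i : V | y i < x i} : Finset V) ∈ H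

/-- The minimal excludant. -/
noncomputable def mex (S : Set ℕ) : ℕ := sInf {i | i ∉ S}

/-- The Sprague-Grundy function of `NIM_H`, defined by recursion along the moves. -/
noncomputable def sg (H : Finset (Finset V)) (x : V → ℕ) : ℕ :=
  mex {g | ∃ (y : V → ℕ) (_h : Move H x y), g = sg H y}
termination_by wellFounded_lt.wrap x
decreasing_by exact _h.1

/-- The height of `x`: the maximum length of a sequence of consecutive moves from `x`. -/
noncomputable def height (H : Finset (Finset V)) (x : V → ℕ) : ℕ :=
  sSup {l | ∃ s : ℕ → V → ℕ, s 0 = x ∧ ∀ i < l, Move H (s i) (s (i + 1))}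

/-- The size of a smallest pile. -/
noncomputable def minPile (x : V → ℕ) : ℕ := ⨅ i, x i

/-- `y_H(x) = h_H(x - m(x) e) + 1`. -/
noncomputable def yVal (H : Finset (Finset V)) (x : V → ℕ) : ℕ :=
  height H (fun i => x i - minPile x) + 1

/-- The Jenkyns-Mayberry formula. In the second branch `m(x) > binom(y_H(x), 2)`, so that the
subtraction is the one of integers. -/
noncomputable def jmFormula (H : Finset (Finset V)) (x : V → ℕ) : ℕ :=
  if minPile x ≤ (yVal H x).choose 2 then height H x
  else (yVal H x).choose 2 + (minPile x - (yVal H x).choose 2 - 1) % yVal H x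

/-- `H` is a JM hypergraph: the formula gives the Sprague-Grundy function of `NIM_H`. -/
def IsJM (H : Finset (Finset V)) : Prop := ∀ x : V → ℕ, sg H x = jmFormula H x

/-- All `k`-subsets of `V` that are not contained in any member of `K`. -/
def avoiding (k : ℕ) (K : Finset (Finset V)) : Finset (Finset V) :=
  {E ∈ Finset.powersetCard k Finset.univ | ∀ A ∈ K, ¬ E ⊆ A}

end HypergraphNim

/-! The height of a position is the largest number of hyperedges, with repetition, that can be
packed into it, and changing one pile by one changes it by at most one. The value claim is mex
induction in two halves. No move preserves the formula (`jmFormula_ne_of_move`):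
transversal-freeness leaves a hyperedge untouched, so a move from x keeps the height at least m(x).
This separates the two branches and rules out equal residues. Every smaller value is attained.
Values at least m(x) are realised as heights. A value below m(x) lies in a unique window
[binom(n,2), binom(n+1,2)); after subtracting a suitable constant c, it suffices to reach a position
with an empty pile and height n - 1, and then add c back. The heights come from interpolating
between two moves on one hyperedge, and from passing between hyperedges by basis exchange
(`exists_move_of_chain`). Minimality brings the height to 0 if a pile is empty; otherwise a pivot
hyperedge does the work (`exists_move_to_empty_pile`). For the family at hand, two members of K
sharing k - 1 points coincide, which gives exchange, and the complement of A ∪ {i}, with A ∈ K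
missing i, is a pivot. -/

namespace HypergraphNim

/-! ### Heights as packing numbers -/

section

variable {V : Type*} [DecidableEq V] {H : Finset (Finset V)} {x y : V → ℕ} {l : ℕ}

/-- Some `l` hyperedges of `H`, repetitions allowed, fit together into the position `x`. -/
def Packs (H : Finset (Finset V)) (l : ℕ) (x : V → ℕ) : Prop :=
  ∃ s : Multiset (Finset V), s.card = l ∧ (∀ E ∈ s, E ∈ H) ∧ ∀ i, s.countP (i ∈ ·) ≤ x i

/-- The position obtained from `x` by taking one from each pile in `E`. -/
def dec (E : Finset V) (x : V → ℕ) : V → ℕ := fun i => if i ∈ E then x i - 1 else x i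

/-- The position obtained from `x` by removing all piles in `E`. -/
def clear (E : Finset V) (x : V → ℕ) : V → ℕ := fun i => if i ∈ E then 0 else x i

lemma dec_le (E : Finset V) (x : V → ℕ) : dec E x ≤ x := by
  intro i; simp only [dec]; split_ifs <;> omega

lemma clear_le (E : Finset V) (x : V → ℕ) : clear E x ≤ x := by
  intro i; simp only [clear]; split_ifs <;> omega


lemma Packs.mono (h : Packs H l x) (hxy : x ≤ y) : Packs H l y := by
  obtain ⟨s, h1, h2, h3⟩ := h
  exact ⟨s, h1, h2, fun i => (h3 i).trans (hxy i)⟩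

lemma dec_packs_of_cons {E : Finset V} {s : Multiset (Finset V)} (hH : ∀ F ∈ E ::ₘ s, F ∈ H)
    (hc : ∀ i, (E ::ₘ s).countP (i ∈ ·) ≤ x i) : Packs H s.card (dec E x) := by
  refine ⟨s, rfl, fun F hF => hH F (Multiset.mem_cons_of_mem hF), fun i => ?_⟩
  have := hc i
  rw [Multiset.countP_cons] at this
  unfold dec
  split_ifs at this ⊢ <;> omega

lemma Packs.exists_edge (h : Packs H (l + 1) x) :
    ∃ E ∈ H, (∀ i ∈ E, 0 < x i) ∧ Packs H l (dec E x) := by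
  obtain ⟨s, h1, h2, h3⟩ := h
  obtain ⟨E, hE⟩ := Multiset.card_pos_iff_exists_mem.1 (by omega : 0 < s.card)
  obtain ⟨t, rfl⟩ := Multiset.exists_cons_of_mem hE
  refine ⟨E, h2 E (by simp), fun i hi => ?_, ?_⟩
  · have := h3 i
    rw [Multiset.countP_cons, if_pos hi] at this
    omega
  · have h4 : t.card = l := by simpa using h1
    exact h4 ▸ dec_packs_of_cons h2 h3

lemma clear_le_dec (E : Finset V) (x : V → ℕ) : clear E x ≤ dec E x := by
  intro i; simp only [clear, dec]; split_ifs <;> omega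

lemma packs_zero : Packs H 0 x := ⟨0, by simp⟩

lemma packs_one_iff : Packs H 1 x ↔ ∃ E ∈ H, ∀ i ∈ E, 0 < x i := by
  constructor
  · intro h
    obtain ⟨E, hE, hp, -⟩ := Packs.exists_edge (l := 0) h
    exact ⟨E, hE, hp⟩
  · rintro ⟨E, hE, hp⟩
    refine ⟨{E}, by simp, by simpa using hE, fun i => ?_⟩
    rw [← Multiset.cons_zero, Multiset.countP_cons]
    by_cases hi : i ∈ E
    · simpa [hi] using Nat.succ_le_of_lt (hp i hi)
    · simp [hi]

variable [Fintype V]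

lemma Packs.of_move (hm : Move H x y) (h : Packs H l y) : Packs H (l + 1) x := by
  obtain ⟨s, h1, h2, h3⟩ := h
  refine ⟨({i : V | y i < x i} : Finset V) ::ₘ s, by simp [h1], ?_, ?_⟩
  · intro E hE
    rcases Multiset.mem_cons.1 hE with rfl | hE
    · exact hm.2
    · exact h2 E hE
  · intro i
    have := h3 i
    have h4 : y i ≤ x i := hm.1.le i
    rw [Multiset.countP_cons]
    simp only [Finset.mem_filter, Finset.mem_univ, true_and]
    split_ifs <;> omega

/-- A position between `clear E x` and `dec E x` is reached from `x` by a move on `E`. -/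
lemma move_of_le {E : Finset V} (h0 : ∅ ∉ H) (hE : E ∈ H) (hpos : ∀ i ∈ E, 0 < x i)
    (h1 : clear E x ≤ y) (h2 : y ≤ dec E x) : Move H x y := by
  have key : ({i : V | y i < x i} : Finset V) = E := by
    ext i
    have a := h1 i
    have b := h2 i
    unfold clear at a
    unfold dec at b
    simp only [Finset.mem_filter, Finset.mem_univ, true_and]
    by_cases hi : i ∈ E
    · have := hpos i hi
      simp only [hi, if_true] at b ⊢
      simp only [iff_true]
      omega
    · simp only [hi, if_false] at a b ⊢
      simp only [iff_false]
      omega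
  refine ⟨lt_of_le_of_ne (h2.trans (dec_le E x)) ?_, key ▸ hE⟩
  rintro rfl
  have : E = ∅ := by rw [← key]; simp
  exact h0 (this ▸ hE)

lemma Packs.exists_move (h0 : ∅ ∉ H) (h : Packs H (l + 1) x) : ∃ y, Move H x y ∧ Packs H l y := by
  obtain ⟨E, hE, hp, h⟩ := h.exists_edge
  exact ⟨_, move_of_le h0 hE hp (clear_le_dec E x) le_rfl, h⟩

lemma Packs.of_succ (h0 : ∅ ∉ H) (h : Packs H (l + 1) x) : Packs H l x := by
  obtain ⟨y, hm, h⟩ := h.exists_move h0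
  exact h.mono hm.1.le

lemma Packs.of_le (h0 : ∅ ∉ H) {l' : ℕ} (h : Packs H l x) (hl : l' ≤ l) : Packs H l' x := by
  induction hl with
  | refl => exact h
  | step _ ih => exact ih (h.of_succ h0)

lemma Packs.le_sum (h0 : ∅ ∉ H) (h : Packs H l x) : l ≤ ∑ i, x i := by
  induction l generalizing x with
  | zero => omega
  | succ l ih =>
    obtain ⟨y, hm, h⟩ := h.exists_move h0
    have := ih h
    obtain ⟨hle, i, hi⟩ := Pi.lt_def.1 hm.1
    have : ∑ i, y i < ∑ i, x i :=
      Finset.sum_lt_sum (fun i _ => hle i) ⟨i, Finset.mem_univ i, hi⟩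
    omega

/-- Only the multiset of hyperedges played matters: a play may always take a single unit from each
pile, in any order. -/
lemma packs_iff_exists_moves (h0 : ∅ ∉ H) :
    (∃ s : ℕ → V → ℕ, s 0 = x ∧ ∀ i < l, Move H (s i) (s (i + 1))) ↔ Packs H l x := by
  constructor
  · rintro ⟨s, rfl, hs⟩
    induction l generalizing s with
    | zero => exact packs_zero
    | succ l ih =>
      exact (ih (fun n => s (n + 1)) fun i hi => hs (i + 1) (by omega)).of_move (hs 0 (by omega))
  · intro h
    induction l generalizing x with
    | zero => exact ⟨fun _ => x, rfl, by simp⟩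
    | succ l ih =>
      obtain ⟨y, hm, h⟩ := h.exists_move h0
      obtain ⟨s, rfl, hs⟩ := ih h
      refine ⟨fun n => Nat.casesOn n x s, rfl, fun i hi => ?_⟩
      cases i with
      | zero => exact hm
      | succ i => exact hs i (by omega)

lemma le_height_iff (h0 : ∅ ∉ H) : l ≤ height H x ↔ Packs H l x := by
  have hset : {l | ∃ s : ℕ → V → ℕ, s 0 = x ∧ ∀ i < l, Move H (s i) (s (i + 1))}
      = {l | Packs H l x} := by
    ext l; exact packs_iff_exists_moves h0
  have hb : BddAbove {l | Packs H l x} := ⟨_, fun l hl => Packs.le_sum h0 hl⟩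
  unfold height
  rw [hset]
  refine ⟨fun h => Packs.of_le h0 (Nat.sSup_mem ⟨0, packs_zero⟩ hb) h, fun h => le_csSup hb h⟩

lemma height_mono (h0 : ∅ ∉ H) (hxy : x ≤ y) : height H x ≤ height H y :=
  (le_height_iff h0).2 (((le_height_iff h0).1 le_rfl).mono hxy)

lemma height_lt_of_move (h0 : ∅ ∉ H) (hm : Move H x y) : height H y < height H x :=
  (le_height_iff h0).2 (Packs.of_move hm ((le_height_iff h0).1 le_rfl))

lemma exists_le_height_dec (h0 : ∅ ∉ H) (h : l < height H x) :
    ∃ E ∈ H, (∀ i ∈ E, 0 < x i) ∧ l ≤ height H (dec E x) := by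
  obtain ⟨E, hE, hp, h⟩ := ((le_height_iff h0).1 h).exists_edge
  exact ⟨E, hE, hp, (le_height_iff h0).2 h⟩

/-- Discarding one packed hyperedge through `b`, if there is one, makes room for the missing unit.
-/
lemma height_le_succ (h0 : ∅ ∉ H) {b : V} (h : ∀ i ≠ b, x i ≤ y i) (hb : x b ≤ y b + 1) :
    height H x ≤ height H y + 1 := by
  rcases Nat.eq_zero_or_pos (height H x) with hx | hx
  · omega
  obtain ⟨l, hl⟩ := Nat.exists_eq_succ_of_ne_zero hx.ne'
  obtain ⟨s, h1, h2, h3⟩ := (le_height_iff h0).1 hl.ge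
  suffices Packs H l y by
    have := (le_height_iff h0).2 this
    omega
  by_cases hs : ∃ E ∈ s, b ∈ E
  · obtain ⟨E, hE, hbE⟩ := hs
    obtain ⟨t, rfl⟩ := Multiset.exists_cons_of_mem hE
    refine ⟨t, by simpa using h1, fun F hF => h2 F (by simp [hF]), fun i => ?_⟩
    have h4 := h3 i
    rw [Multiset.countP_cons] at h4
    by_cases hi : i = b
    · subst hi
      rw [if_pos hbE] at h4
      omega
    · have := h i hi
      split_ifs at h4 <;> omega
  · refine Packs.of_succ h0 ⟨s, h1, h2, fun i => ?_⟩
    by_cases hi : i = b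
    · subst hi
      rw [Multiset.countP_eq_zero.2 fun E hE hbE => hs ⟨E, hE, hbE⟩]
      omega
    · exact (h3 i).trans (h i hi)

/-- Between comparable positions the height takes all intermediate values. -/
lemma exists_height_eq (h0 : ∅ ∉ H) (hyx : y ≤ x) (h1 : height H y ≤ l) (h2 : l ≤ height H x) :
    ∃ z, y ≤ z ∧ z ≤ x ∧ height H z = l := by
  -- A minimal position of height at least `l` has height exactly `l`: otherwise a pile still above
  -- `y` could lose one more unit.
  obtain ⟨z, ⟨hyz, hzx, hz⟩, hmin⟩ :=
    wellFounded_lt.has_min {z : V → ℕ | y ≤ z ∧ z ≤ x ∧ l ≤ height H z} ⟨x, hyx, le_rfl, h2⟩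
  refine ⟨z, hyz, hzx, le_antisymm ?_ hz⟩
  by_contra! hlt
  have hne : ¬ z ≤ y := fun h => by
    have := height_mono (H := H) h0 h
    omega
  obtain ⟨b, hb⟩ := not_forall.1 hne
  have hb : y b < z b := not_le.1 hb
  have hle : Function.update z b (z b - 1) ≤ z := by
    intro i
    by_cases hi : i = b
    · subst hi; simp
    · simp [hi]
  refine hmin (Function.update z b (z b - 1)) ⟨?_, hle.trans hzx, ?_⟩ ?_
  · intro i
    by_cases hi : i = b
    · subst hi; rw [Function.update_self]; exact Nat.le_sub_one_of_lt hb
    · simpa [hi] using hyz i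
  · have := height_le_succ (x := z) (y := Function.update z b (z b - 1)) (b := b) h0
      (fun i hi => by simp [hi]) (by simp; omega)
    omega
  · refine Pi.lt_def.2 ⟨hle, b, ?_⟩
    rw [Function.update_self]; omega

lemma le_height_of_edge (h0 : ∅ ∉ H) {E : Finset V} (hE : E ∈ H) (h : ∀ i ∈ E, l ≤ x i) :
    l ≤ height H x := by
  refine (le_height_iff h0).2 ⟨Multiset.replicate l E, by simp, ?_, fun i => ?_⟩
  · intro F hF
    exact Multiset.eq_of_mem_replicate hF ▸ hE
  · by_cases hi : i ∈ E
    · exact ((Multiset.countP_le_card _ _).trans (by simp)).trans (h i hi)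
    · rw [Multiset.countP_eq_zero.2 fun F hF => Multiset.eq_of_mem_replicate hF ▸ hi]
      exact Nat.zero_le _

/-- If all edges that fit into `x` use the pile `i`, the height is at most `x i`. -/
lemma height_le_of_forall_mem (h0 : ∅ ∉ H) (i : V) (h : ∀ E ∈ H, (∀ j ∈ E, 0 < x j) → i ∈ E) :
    height H x ≤ x i := by
  obtain ⟨s, h1, h2, h3⟩ := (le_height_iff h0).1 (le_refl (height H x))
  have hs : s.countP (i ∈ ·) = s.card := Multiset.countP_eq_card.2 fun E hE =>
    h E (h2 E hE) fun j hj => (Multiset.countP_pos.2 ⟨E, hE, hj⟩).trans_le (h3 j)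
  rw [← h1, ← hs]
  exact h3 i

end

/-! ### Attaining heights by moves -/

section

variable {V : Type*} [Fintype V] [DecidableEq V] {H : Finset (Finset V)} {x y : V → ℕ} {l : ℕ}

/-- The basis exchange property. -/
def Exchange (H : Finset (Finset V)) : Prop :=
  ∀ E ∈ H, ∀ F ∈ H, ∀ a ∈ E \ F, ∃ b ∈ F \ E, insert b (E.erase a) ∈ H

lemma exists_move_of_edge (h0 : ∅ ∉ H) {C E : Finset V} (hE : E ∈ H) (hp : ∀ i ∈ E, 0 < x i)
    (hC : C ⊆ E) (h1 : height H (clear E x) ≤ l) (h2 : l ≤ height H (clear C (dec E x))) :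
    ∃ y, Move H x y ∧ (∀ i ∈ C, y i = 0) ∧ height H y = l := by
  have hle : clear E x ≤ clear C (dec E x) := by
    intro i
    have := @hC i
    simp only [clear, dec]
    split_ifs <;> simp_all
  obtain ⟨z, hz1, hz2, hz⟩ := exists_height_eq h0 hle h1 h2
  refine ⟨z, move_of_le h0 hE hp hz1 (hz2.trans (clear_le _ _)), fun i hi => ?_, hz⟩
  have := hz2 i
  simpa [clear, hi] using this

/-- Along a chain of basis exchanges from `E` to `F`, moves that remove all piles in `C ⊆ E ∩ F`
attain every height between the largest one on `E` and the smallest one on `F`. -/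
lemma exists_move_of_chain (h0 : ∅ ∉ H) (hex : Exchange H) {C E F : Finset V} (hE : E ∈ H)
    (hF : F ∈ H) (hpE : ∀ i ∈ E, 0 < x i) (hpF : ∀ i ∈ F, 0 < x i) (hCE : C ⊆ E) (hCF : C ⊆ F)
    (h1 : height H (clear F x) ≤ l) (h2 : l ≤ height H (clear C (dec E x))) :
    ∃ y, Move H x y ∧ (∀ i ∈ C, y i = 0) ∧ height H y = l := by
  induction hn : (E \ F).card using Nat.strong_induction_on generalizing E with
  | _ n ih =>
    subst hn
    by_cases hl : height H (clear E x) ≤ l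
    · exact exists_move_of_edge h0 hE hpE hCE hl h2
    -- Uniformity is not assumed; exchange itself forbids proper inclusions between hyperedges.
    have hEF : (E \ F).Nonempty := by
      rw [Finset.sdiff_nonempty]
      intro hsub
      have hcl : E ≠ F := by
        rintro rfl
        exact hl h1
      obtain ⟨b, hbF, hbE⟩ := Finset.exists_of_ssubset (hsub.ssubset_of_ne hcl)
      obtain ⟨c, hc, -⟩ := hex F hF E hE b (by simp [hbF, hbE])
      rw [Finset.mem_sdiff] at hc
      exact hc.2 (hsub hc.1)
    obtain ⟨a, ha⟩ := hEF
    obtain ⟨b, hb, hE'⟩ := hex E hE F hF a ha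
    rw [Finset.mem_sdiff] at ha hb
    refine ih _ ?_ hE' ?_ ?_ ?_ rfl
    · refine Finset.card_lt_card (Finset.ssubset_iff_of_subset ?_ |>.2 ⟨a, by simp [ha], ?_⟩)
      · intro c
        simp only [Finset.mem_sdiff, Finset.mem_insert, Finset.mem_erase]
        rintro ⟨rfl | h, hc⟩
        · exact absurd hb.1 hc
        · exact ⟨h.2, hc⟩
      · have : a ≠ b := fun h => ha.2 (h ▸ hb.1)
        simp [this]
    · intro c hc
      rcases Finset.mem_insert.1 hc with rfl | hc
      · exact hpF _ hb.1
      · exact hpE _ (Finset.mem_of_mem_erase hc)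
    · intro c hc
      refine Finset.mem_insert_of_mem (Finset.mem_erase.2 ⟨?_, hCE hc⟩)
      rintro rfl
      exact ha.2 (hCF hc)
    · have hbC : b ∉ C := fun h => hb.2 (hCE h)
      -- The ranges of consecutive hyperedges leave no gap: the lowest position on `E` exceeds the
      -- highest one on the next hyperedge only at `b`, and there by one unit.
      have key : height H (clear E x)
          ≤ height H (clear C (dec (insert b (E.erase a)) x)) + 1 := by
        refine height_le_succ h0 (b := b) (fun i hi => ?_) ?_
        · have := @hCE i
          simp only [clear, dec, Finset.mem_insert, Finset.mem_erase]
          split_ifs <;> simp_all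
        · simp only [clear, dec, Finset.mem_insert, hbC, hb.2]
          simp
          omega
      omega

/-- In a position with an empty pile all smaller heights are attained. -/
lemma exists_move_of_empty_pile (h0 : ∅ ∉ H) (hex : Exchange H) (hmin : IsMinimalTransversalFree H)
    {i : V} (hi : x i = 0) (hl : l < height H x) : ∃ y, Move H x y ∧ height H y = l := by
  obtain ⟨E, hE, hp, hle⟩ := exists_le_height_dec h0 hl
  set S : Finset V := {j | 0 < x j} with hS
  have hS1 : S ≠ Finset.univ := by
    intro h
    have : i ∈ S := h ▸ Finset.mem_univ i
    simp [hS, hi] at this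
  have hES : E ∈ induced H S := by
    simp only [induced, Finset.mem_filter]
    exact ⟨hE, fun j hj => by simpa [hS] using hp j hj⟩
  -- Minimality on the set of nonempty piles gives a hyperedge meeting all playable ones, so
  -- clearing it ends the game.
  have h := hmin.2 S hS1 ⟨E, hES⟩
  simp only [IsTransversalFree, not_forall, not_not] at h
  obtain ⟨F, hF, hFt⟩ := h
  have hF' := hF
  simp only [induced, Finset.mem_filter] at hF
  have hpF : ∀ j ∈ F, 0 < x j := fun j hj => by simpa [hS] using hF.2 hj
  have hz : height H (clear F x) = 0 := by
    by_contra hne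
    obtain ⟨T, hT, hTp⟩ := packs_one_iff.1 ((le_height_iff h0).1 (Nat.one_le_iff_ne_zero.2 hne))
    have hT' : T ∈ induced H S := by
      simp only [induced, Finset.mem_filter]
      refine ⟨hT, fun j hj => ?_⟩
      have := (hTp j hj).trans_le (clear_le F x j)
      simpa [hS] using this
    obtain ⟨j, hj⟩ := hFt T hT'
    rw [Finset.mem_inter] at hj
    have := hTp j hj.2
    simp [clear, hj.1] at this
  obtain ⟨y, hy, -, hyl⟩ := exists_move_of_chain h0 hex hE hF.1 hp hpF (Finset.empty_subset _)
    (Finset.empty_subset _) (by omega)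
    (hle.trans (height_mono h0 fun j => by simp [clear]))
  exact ⟨y, hy, hyl⟩

/-- `E` is a hyperedge off `i` that meets every hyperedge off `i`, that can exchange each of its
elements for `i`, and whose elements are interchangeable for the hyperedges that meet `E` in one
element and miss `i`. -/
structure IsPivot (H : Finset (Finset V)) (i : V) (E : Finset V) : Prop where
  one_lt_card : 1 < E.card
  mem : E ∈ H
  notMem : i ∉ E
  meets : ∀ F ∈ H, Disjoint F E → i ∈ F
  exchange : ∀ b ∈ E, insert i (E.erase b) ∈ H
  swap : ∀ b ∈ E, ∀ c ∈ E, b ≠ c → ∀ F ∈ H, Disjoint F (insert i (E.erase b)) →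
    b ∈ F ∧ insert c (F.erase b) ∈ H

/-- Every hyperedge packed after clearing E - b + i uses `b`, so there are at most `x b ≤ x c` of
them. Dropping one and replacing `b` by `c` in the rest yields a packing that avoids `b` and fits
even after `c` loses a unit. -/
lemma IsPivot.height_clear_le (h0 : ∅ ∉ H) {i : V} {E : Finset V} (h : IsPivot H i E) {b c : V}
    (hb : b ∈ E) (hc : c ∈ E) (hbc : b ≠ c) (hx : x b ≤ x c) :
    height H (clear (insert i (E.erase b)) x) ≤ height H (clear {b} (dec E x)) + 1 := by
  set F := insert i (E.erase b) with hF
  rcases Nat.eq_zero_or_pos (height H (clear F x)) with hz | hz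
  · omega
  obtain ⟨s, h1, h2, h3⟩ := (le_height_iff h0).1 (le_refl (height H (clear F x)))
  have hdis : ∀ T ∈ s, Disjoint T F := by
    intro T hT
    rw [Finset.disjoint_left]
    intro j hj hjF
    have h4 := h3 j
    have : 0 < s.countP (j ∈ ·) := Multiset.countP_pos.2 ⟨T, hT, hj⟩
    simp only [clear, hjF, if_true] at h4
    omega
  have hbs : ∀ T ∈ s, b ∈ T := fun T hT => (h.swap b hb c hc hbc T (h2 T hT) (hdis T hT)).1
  have hcard : s.card ≤ x b := by
    have hs : s.countP (b ∈ ·) = s.card := Multiset.countP_eq_card.2 hbs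
    rw [← hs]
    exact (h3 b).trans (clear_le _ _ _)
  obtain ⟨T, hT⟩ := Multiset.card_pos_iff_exists_mem.1 (h1 ▸ hz)
  obtain ⟨t, rfl⟩ := Multiset.exists_cons_of_mem hT
  rw [Multiset.card_cons] at h1 hcard
  rw [← h1]
  refine Nat.succ_le_succ ((le_height_iff h0).2
    ⟨t.map fun T => insert c (T.erase b), by simp, ?_, fun j => ?_⟩)
  · intro T' hT'
    obtain ⟨T, hT, rfl⟩ := Multiset.mem_map.1 hT'
    have hT := Multiset.mem_cons_of_mem (b := T) hT
    exact (h.swap b hb c hc hbc _ (h2 _ (Multiset.mem_cons_of_mem ‹_›))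
      (hdis _ (Multiset.mem_cons_of_mem ‹_›))).2
  · by_cases hjb : j = b
    · subst hjb
      rw [Multiset.countP_eq_zero.2]
      · exact Nat.zero_le _
      · intro T' hT'
        obtain ⟨T, hT, rfl⟩ := Multiset.mem_map.1 hT'
        simp [hbc]
    by_cases hjc : j = c
    · subst hjc
      refine (Multiset.countP_le_card _ _).trans ?_
      rw [Multiset.card_map]
      simp only [clear, dec, Finset.mem_singleton, hjb, hc, if_true, if_false]
      omega
    have h5 : (t.map fun T => insert c (T.erase b)).countP (j ∈ ·) = t.countP (j ∈ ·) := by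
      rw [Multiset.countP_map, Multiset.countP_eq_card_filter]
      simp [hjb, hjc]
    have h6 := h3 j
    rw [Multiset.countP_cons] at h6
    rw [h5]
    by_cases hjE : j ∈ E
    · have hjF : j ∈ F := by simp [hF, hjE, hjb]
      simp only [clear, hjF, if_true] at h6
      omega
    · have := clear_le F x j
      simp only [clear, dec, Finset.mem_singleton, hjb, hjE, if_false] at h6 this ⊢
      omega

/-- In a position without empty piles, moves that create an empty pile attain all heights from the
smallest pile `i` up to those reached by removing `i` completely. -/
lemma exists_move_to_empty_pile (h0 : ∅ ∉ H) (hex : Exchange H) {i : V} {E : Finset V}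
    (hE : IsPivot H i E) (hi : 0 < x i) (hmin : ∀ j, x i ≤ x j) {E₀ : Finset V} (hE₀ : E₀ ∈ H)
    (hiE₀ : i ∈ E₀) (h1 : x i ≤ l) (h2 : l ≤ height H (clear {i} (dec E₀ x))) :
    ∃ y, Move H x y ∧ (∃ j, y j = 0) ∧ height H y = l := by
  have hp : ∀ j, 0 < x j := fun j => hi.trans_le (hmin j)
  obtain ⟨b, hb, hbmin⟩ := E.exists_min_image x (Finset.card_pos.1 (by have := hE.one_lt_card; omega))
  -- Exchanges from `E₀` to E - b + i, with `i` emptied throughout, cover the upper heights. Moves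
  -- on `E` that empty `b` cover the rest, down to `x i`; `height_clear_le` closes the gap, and it
  -- needs `b` to be a smallest pile of `E`.
  by_cases hl : height H (clear (insert i (E.erase b)) x) ≤ l
  · obtain ⟨y, hy, hyi, hyl⟩ := exists_move_of_chain (C := {i}) h0 hex hE₀ (hE.exchange b hb)
      (fun j _ => hp j) (fun j _ => hp j) (by simpa) (by simp) hl h2
    exact ⟨y, hy, ⟨i, hyi i (by simp)⟩, hyl⟩
  · obtain ⟨c, hc, hcb⟩ := Finset.exists_mem_ne hE.one_lt_card b
    have := hE.height_clear_le (x := x) h0 hb hc hcb.symm (hbmin c hc)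
    have hbot : height H (clear E x) ≤ x i := by
      refine (height_le_of_forall_mem h0 i fun F hF hFp => hE.meets F hF ?_).trans (clear_le E x i)
      rw [Finset.disjoint_left]
      intro j hj hjE
      have := hFp j hj
      simp [clear, hjE] at this
    obtain ⟨y, hy, hyb, hyl⟩ := exists_move_of_edge (C := {b}) (l := l) h0 hE.mem (fun j _ => hp j)
      (by simpa) (hbot.trans h1) (by omega)
    exact ⟨y, hy, ⟨b, hyb b (by simp)⟩, hyl⟩

end

/-! ### The Jenkyns–Mayberry formula and the mex induction -/

section

variable {V : Type*} {H : Finset (Finset V)} {x y : V → ℕ} {l : ℕ}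

lemma minPile_le (x : V → ℕ) (i : V) : minPile x ≤ x i := ciInf_le (OrderBot.bddBelow _) i

lemma minPile_eq {i : V} (h : ∀ j, x i ≤ x j) : minPile x = x i :=
  have : Nonempty V := ⟨i⟩
  le_antisymm (minPile_le x i) (le_ciInf h)

variable [Fintype V]

lemma exists_eq_minPile [Nonempty V] (x : V → ℕ) : ∃ i, x i = minPile x :=
  exists_eq_ciInf_of_finite

lemma jmFormula_of_le (h : minPile x ≤ (yVal H x).choose 2) : jmFormula H x = height H x := if_pos h

lemma jmFormula_of_empty_pile {i : V} (hi : x i = 0) : jmFormula H x = height H x := by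
  refine jmFormula_of_le ?_
  have := minPile_le x i
  omega

lemma one_le_yVal : 1 ≤ yVal H x := Nat.le_add_left _ _

lemma jmFormula_of_lt (h : (yVal H x).choose 2 < minPile x) :
    jmFormula H x = (yVal H x).choose 2 + (minPile x - (yVal H x).choose 2 - 1) % yVal H x :=
  if_neg (not_le.2 h)

lemma jmFormula_lt_minPile (h : (yVal H x).choose 2 < minPile x) : jmFormula H x < minPile x := by
  rw [jmFormula_of_lt h]
  have := Nat.mod_le (minPile x - (yVal H x).choose 2 - 1) (yVal H x)
  omega

lemma choose_two_succ (n : ℕ) : (n + 1).choose 2 = n.choose 2 + n := by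
  rw [Nat.choose_succ_succ' n 1, Nat.choose_one_right, add_comm]

/-- These windows tile ℕ, and the second branch with `yVal` equal to `n` takes its values in the
`n`-th; such a value thus determines `yVal`. -/
lemma exists_choose_two_window (v : ℕ) : ∃ n, 1 ≤ n ∧ n.choose 2 ≤ v ∧ v < n.choose 2 + n := by
  have hex : ∃ n, v < (n + 1).choose 2 := by
    refine ⟨v + 1, ?_⟩
    rw [choose_two_succ]
    omega
  classical
  have h := Nat.find_spec hex
  rcases hn : Nat.find hex with _ | n
  · rw [hn] at h
    simp at h
  · rw [hn] at h
    refine ⟨n + 1, by omega, ?_, by rwa [← choose_two_succ]⟩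
    have := Nat.find_min hex (m := n) (by omega)
    omega

lemma lt_of_choose_two_lt {m n : ℕ} (h : m.choose 2 < n.choose 2) : m < n := by
  by_contra! hle
  have := Nat.choose_le_choose 2 hle
  omega

lemma choose_two_window_unique {m n v : ℕ} (h1 : m.choose 2 ≤ v) (h2 : v < m.choose 2 + m)
    (h3 : n.choose 2 ≤ v) (h4 : v < n.choose 2 + n) : m = n := by
  rw [← choose_two_succ] at h2 h4
  have := lt_of_choose_two_lt (h1.trans_lt h4)
  have := lt_of_choose_two_lt (h3.trans_lt h2)
  omega

lemma Move.sub (hm : Move H x y) {c : ℕ} (hc : ∀ i, c ≤ y i) :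
    Move H (fun i => x i - c) (fun i => y i - c) := by
  obtain ⟨hlt, hmem⟩ := hm
  obtain ⟨hle, i, hi⟩ := Pi.lt_def.1 hlt
  have key : ({i : V | y i - c < x i - c} : Finset V) = ({i : V | y i < x i} : Finset V) := by
    ext j
    have := hc j
    simp only [Finset.mem_filter, Finset.mem_univ, true_and]
    omega
  refine ⟨Pi.lt_def.2 ⟨fun j => Nat.sub_le_sub_right (hle j) c, i, ?_⟩, key ▸ hmem⟩
  have := hc i
  change y i - c < x i - c
  omega

lemma Move.add {c : ℕ} (hm : Move H (fun i => x i - c) y) (hc : ∀ i, c ≤ x i) :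
    Move H x (fun i => y i + c) := by
  obtain ⟨hlt, hmem⟩ := hm
  obtain ⟨hle, i, hi⟩ := Pi.lt_def.1 hlt
  have key : ({i : V | y i < x i - c} : Finset V) = ({i : V | y i + c < x i} : Finset V) := by
    ext j
    have := hc j
    simp only [Finset.mem_filter, Finset.mem_univ, true_and]
    omega
  refine ⟨Pi.lt_def.2 ⟨fun j => ?_, i, ?_⟩, key ▸ hmem⟩
  · have h1 : y j ≤ x j - c := hle j
    have := hc j
    change y j + c ≤ x j
    omega
  · change y i < x i - c at hi
    change y i + c < x i
    omega

lemma minPile_le_of_move [Nonempty V] (hm : Move H x y) : minPile y ≤ minPile x := by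
  obtain ⟨i, hi⟩ := exists_eq_minPile x
  exact hi ▸ (minPile_le y i).trans (hm.1.le i)

/-- Adding a constant `c` to a position with an empty pile. -/
lemma jmFormula_add {c v n : ℕ} {j : V} (hj : y j = 0) (hn : height H y + 1 = n)
    (h1 : n.choose 2 ≤ v) (h2 : v < n.choose 2 + n) (hc : v < c) (hmod : n ∣ c - (v + 1)) :
    jmFormula H (fun i => y i + c) = v := by
  have hm : minPile (fun i => y i + c) = c := by
    rw [minPile_eq (i := j)] <;> simp [hj]
  have hy : yVal H (fun i => y i + c) = n := by
    simp [yVal, hm, hn]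
  rw [jmFormula_of_lt (by rw [hm, hy]; omega), hm, hy]
  obtain ⟨q, hq⟩ := hmod
  have : c - n.choose 2 - 1 = (v - n.choose 2) + n * q := by omega
  rw [this, Nat.add_mul_mod_self_left, Nat.mod_eq_of_lt (by omega)]
  omega

variable [DecidableEq V]

/-- After a move, some hyperedge is untouched. -/
lemma minPile_sub_le_height (h0 : ∅ ∉ H) (htf : ∀ E ∈ H, ∃ F ∈ H, Disjoint E F) (hm : Move H x y)
    (c : ℕ) : minPile x - c ≤ height H fun i => y i - c := by
  obtain ⟨F, hF, hd⟩ := htf _ hm.2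
  refine le_height_of_edge h0 hF fun i hi => ?_
  have h1 : ¬ y i < x i := fun h => Finset.disjoint_left.1 hd (by simpa using h) hi
  have h2 : y i ≤ x i := hm.1.le i
  have h3 := minPile_le x i
  omega

/-- No move preserves the value of the formula. -/
lemma jmFormula_ne_of_move [Nonempty V] (h0 : ∅ ∉ H) (htf : ∀ E ∈ H, ∃ F ∈ H, Disjoint E F)
    (hm : Move H x y) : jmFormula H y ≠ jmFormula H x := by
  intro heq
  have hlt := height_lt_of_move h0 hm
  have hmin := minPile_le_of_move hm
  have hc := minPile_sub_le_height h0 htf hm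
  have hc0 : minPile x ≤ height H y := by simpa using hc 0
  rcases le_or_gt (minPile x) ((yVal H x).choose 2) with hx | hx
  · rw [jmFormula_of_le hx] at heq
    rcases le_or_gt (minPile y) ((yVal H y).choose 2) with hy | hy
    · rw [jmFormula_of_le hy] at heq
      omega
    · have := jmFormula_lt_minPile hy
      omega
  · have hxm := jmFormula_lt_minPile hx
    rcases le_or_gt (minPile y) ((yVal H y).choose 2) with hy | hy
    · rw [jmFormula_of_le hy] at heq
      omega
    · rw [jmFormula_of_lt hx, jmFormula_of_lt hy] at heq
      have m1 := Nat.mod_lt (minPile x - (yVal H x).choose 2 - 1) (one_le_yVal (H := H) (x := x))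
      have m2 := Nat.mod_lt (minPile y - (yVal H y).choose 2 - 1) (one_le_yVal (H := H) (x := y))
      have hY : yVal H y = yVal H x :=
        choose_two_window_unique (Nat.le_add_right _ _) (Nat.add_lt_add_left m2 _)
          (heq ▸ Nat.le_add_right _ _) (heq ▸ Nat.add_lt_add_left m1 _)
      rw [hY] at heq hy
      -- With equal minima, the translated positions are joined by a move yet have equal heights.
      -- Otherwise the minima differ by a positive multiple of `yVal`, whereas the untouched
      -- hyperedge bounds the difference by `yVal - 1`.
      rcases hmin.eq_or_lt with he | hl
      · have := height_lt_of_move h0 (hm.sub (c := minPile y) (minPile_le y))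
        unfold yVal at hY
        rw [he] at hY this
        omega
      · have hmod : minPile y - (yVal H x).choose 2 - 1 ≡ minPile x - (yVal H x).choose 2 - 1
            [MOD yVal H x] := Nat.add_left_cancel heq
        have hdvd := (Nat.modEq_iff_dvd' (by omega)).1 hmod
        have hle := Nat.le_of_dvd (by omega) hdvd
        have h5 := hc (minPile y)
        have h6 : yVal H y = (height H fun i => y i - minPile y) + 1 := rfl
        omega

/-- If no packed hyperedge uses `i`, one of them can be traded for a hyperedge through `i`: the
extra unit taken from pile `i` is not needed by the others. -/
lemma exists_edge_through (h0 : ∅ ∉ H) (hadd : ∀ E ∈ H, ∀ i, ∃ F ∈ H, i ∈ F ∧ F ⊆ insert i E)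
    (i : V) (hl : l < height H x) :
    ∃ E ∈ H, i ∈ E ∧ l ≤ height H (dec E x) := by
  obtain ⟨s, h1, h2, h3⟩ := (le_height_iff h0).1 hl
  by_cases hs : ∃ E ∈ s, i ∈ E
  · obtain ⟨E, hE, hiE⟩ := hs
    obtain ⟨t, rfl⟩ := Multiset.exists_cons_of_mem hE
    refine ⟨E, h2 E hE, hiE, (le_height_iff h0).2 ?_⟩
    have h4 : t.card = l := by simpa using h1
    exact h4 ▸ dec_packs_of_cons h2 h3
  · obtain ⟨E, hE⟩ := Multiset.card_pos_iff_exists_mem.1 (by omega : 0 < s.card)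
    obtain ⟨t, rfl⟩ := Multiset.exists_cons_of_mem hE
    obtain ⟨F, hF, hiF, hFE⟩ := hadd E (h2 E hE) i
    refine ⟨F, hF, hiF, (le_height_iff h0).2
      ⟨t, by simpa using h1, fun T hT => h2 T (Multiset.mem_cons_of_mem hT), fun j => ?_⟩⟩
    have h4 := h3 j
    rw [Multiset.countP_cons] at h4
    by_cases hji : j = i
    · subst hji
      rw [Multiset.countP_eq_zero.2 fun T hT hjT => hs ⟨T, Multiset.mem_cons_of_mem hT, hjT⟩]
      exact Nat.zero_le _
    · have h5 : j ∈ F → j ∈ E := fun h => (Finset.mem_insert.1 (hFE h)).resolve_left hji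
      simp only [dec]
      split_ifs at h4 ⊢ with h6 h7 h7
      all_goals first | omega | exact absurd (h5 ‹_›) ‹_›

/-- Values that are at least the smallest pile are attained at positions whose value is the
height. -/
lemma exists_move_jmFormula_of_minPile_le [Nonempty V] (h0 : ∅ ∉ H) (hex : Exchange H)
    (hmin : IsMinimalTransversalFree H) (hadd : ∀ E ∈ H, ∀ i, ∃ F ∈ H, i ∈ F ∧ F ⊆ insert i E)
    (hpiv : ∀ i, ∃ E, IsPivot H i E) (hlong : minPile x ≤ (yVal H x).choose 2)
    (hl : l < height H x) (hml : minPile x ≤ l) : ∃ y, Move H x y ∧ jmFormula H y = l := by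
  obtain ⟨i, hi⟩ := exists_eq_minPile x
  rcases Nat.eq_zero_or_pos (minPile x) with hz | hz
  · obtain ⟨y, hy, hyl⟩ := exists_move_of_empty_pile h0 hex hmin (hi.trans hz) hl
    have : y i ≤ x i := hy.1.le i
    exact ⟨y, hy, (jmFormula_of_empty_pile (i := i) (by omega)).trans hyl⟩
  have hximin : ∀ j, x i ≤ x j := fun j => hi ▸ minPile_le x j
  obtain ⟨E₀, hE₀, hiE₀, hle⟩ := exists_edge_through h0 hadd i hl
  obtain ⟨E, hE⟩ := hpiv i
  rcases le_total l (height H (clear {i} (dec E₀ x))) with h | h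
  · obtain ⟨y, hy, ⟨j, hj⟩, hyl⟩ := exists_move_to_empty_pile h0 hex hE (by omega) hximin hE₀ hiE₀
      (hi ▸ hml) h
    exact ⟨y, hy, (jmFormula_of_empty_pile hj).trans hyl⟩
  -- Only pile `i` varies between these bounds, so it stays smallest. Its loss is at least that of
  -- any other pile, so `yVal` does not drop and `y` remains in the first branch.
  obtain ⟨y, hy1, hy2, hyl⟩ := exists_height_eq h0 (clear_le {i} (dec E₀ x)) h hle
  have hp : ∀ j, 0 < x j := fun j => (hi ▸ hz).trans_le (hximin j)
  have hyi : y i ≤ x i - 1 := by simpa [dec, hiE₀] using hy2 i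
  have hyj : ∀ j, j ≠ i → x j - 1 ≤ y j := fun j hj => by
    refine le_trans ?_ (hy1 j)
    simp only [clear, dec, Finset.mem_singleton, hj, if_false]
    split_ifs <;> omega
  have hym : minPile y = y i := by
    refine minPile_eq fun j => ?_
    by_cases hj : j = i
    · rw [hj]
    · have := hyj j hj
      have := hximin j
      omega
  have hY : yVal H x ≤ yVal H y := by
    refine Nat.succ_le_succ (height_mono h0 fun j => ?_)
    change x j - minPile x ≤ y j - minPile y
    by_cases hj : j = i
    · rw [hj]
      omega
    · have := hyj j hj
      omega
  refine ⟨y, move_of_le h0 hE₀ (fun j _ => hp j) (le_trans ?_ hy1) hy2,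
    (jmFormula_of_le ?_).trans hyl⟩
  · intro j
    simp only [clear, dec, Finset.mem_singleton]
    by_cases hj : j = i
    · simp [hj, hiE₀]
    · by_cases hjE : j ∈ E₀ <;> simp [hj, hjE]
  · have := Nat.choose_le_choose 2 hY
    omega

/-- Values smaller than the smallest pile are attained at positions of the second kind. -/
lemma exists_move_jmFormula_of_lt_minPile [Nonempty V] (h0 : ∅ ∉ H) (hex : Exchange H)
    (hmin : IsMinimalTransversalFree H) (hcov : ∀ v : V, ∃ E ∈ H, v ∈ E)
    (hpiv : ∀ i, ∃ E, IsPivot H i E) (hl : l < jmFormula H x) (hlm : l < minPile x) :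
    ∃ y, Move H x y ∧ jmFormula H y = l := by
  obtain ⟨i, hi⟩ := exists_eq_minPile x
  obtain ⟨n, hn, hn1, hn2⟩ := exists_choose_two_window l
  have hYdef : yVal H x = (height H fun i => x i - minPile x) + 1 := rfl
  have hnd : (minPile x - (l + 1)) % n < n := Nat.mod_lt _ hn
  have hdm := Nat.mod_add_div (minPile x - (l + 1)) n
  have hdle := Nat.mod_le (minPile x - (l + 1)) n
  -- The constant to subtract is `minPile x - d`, the largest one up to `minPile x` congruent to `l
  -- + 1` modulo `n`; the smallest pile left is `d < n`.
  set d := (minPile x - (l + 1)) % n with hd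
  have hcle : ∀ j, minPile x - d ≤ x j := fun j => (Nat.sub_le _ _).trans (minPile_le x j)
  -- If `n = yVal H x`, then `d = 0` would make `l` the value of `x` itself.
  have hnY : n < yVal H x ∨ n = yVal H x ∧ 0 < d := by
    rcases le_or_gt (minPile x) ((yVal H x).choose 2) with hx | hx
    · exact Or.inl (lt_of_choose_two_lt (by omega))
    · have m1 := Nat.mod_lt (minPile x - (yVal H x).choose 2 - 1) (one_le_yVal (H := H) (x := x))
      have hf := jmFormula_of_lt hx
      have h1 : n.choose 2 < (yVal H x + 1).choose 2 := by
        rw [choose_two_succ]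
        omega
      have h2 := lt_of_choose_two_lt h1
      rcases (Nat.lt_succ_iff.1 h2).lt_or_eq with h | h
      · exact Or.inl h
      · refine Or.inr ⟨h, Nat.pos_of_ne_zero fun hd0 => ?_⟩
        rw [← h] at hf
        have h3 : minPile x - n.choose 2 - 1
            = (l - n.choose 2) + n * ((minPile x - (l + 1)) / n) := by omega
        rw [h3, Nat.add_mul_mod_self_left, Nat.mod_eq_of_lt (by omega)] at hf
        omega
  suffices ∃ y, Move H (fun j => x j - (minPile x - d)) y ∧ (∃ j, y j = 0) ∧
      height H y = n - 1 by
    obtain ⟨y, hy, ⟨j, hj⟩, hyn⟩ := this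
    refine ⟨_, hy.add hcle, jmFormula_add hj (by omega) hn1 hn2 (by omega) ?_⟩
    exact ⟨(minPile x - (l + 1)) / n, by omega⟩
  rcases Nat.eq_zero_or_pos d with hd0 | hd0
  · rw [hd0, Nat.sub_zero]
    obtain ⟨y, hy, hyl⟩ := exists_move_of_empty_pile (x := fun j => x j - minPile x) (l := n - 1)
      h0 hex hmin (i := i) (by simp [hi]) (by omega)
    refine ⟨y, hy, ⟨i, ?_⟩, hyl⟩
    have : y i ≤ x i - minPile x := hy.1.le i
    omega
  · obtain ⟨E, hE⟩ := hpiv i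
    obtain ⟨E₀, hE₀, hiE₀⟩ := hcov i
    refine exists_move_to_empty_pile h0 hex hE ?_ ?_ hE₀ hiE₀ ?_ ?_
    · omega
    · intro j
      have := minPile_le x j
      change x i - (minPile x - d) ≤ x j - (minPile x - d)
      omega
    · omega
    · refine le_trans (by omega : n - 1 ≤ height H fun i => x i - minPile x)
        (height_mono h0 fun j => ?_)
      by_cases hj : j = i
      · simp [hj, hi]
      · have := minPile_le x j
        simp only [clear, dec, Finset.mem_singleton, hj, if_false]
        split_ifs <;> omega

lemma mex_eq {S : Set ℕ} {n : ℕ} (h1 : n ∉ S) (h2 : ∀ m < n, m ∈ S) : mex S = n :=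
  le_antisymm (Nat.sInf_le h1) (le_csInf ⟨n, h1⟩ fun m hm => not_lt.1 fun h => hm (h2 m h))

/-- This isolates the combinatorial properties that the game analysis needs; the family K plays no
part in it. -/
theorem isJM_of_isPivot [Nonempty V] (hH : IsHypergraph H) (hex : Exchange H)
    (hmin : IsMinimalTransversalFree H) (hadd : ∀ E ∈ H, ∀ i, ∃ F ∈ H, i ∈ F ∧ F ⊆ insert i E)
    (hpiv : ∀ i, ∃ E, IsPivot H i E) : IsJM H := by
  have h0 := hH.empty_notMem
  have htf : ∀ E ∈ H, ∃ F ∈ H, Disjoint E F := by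
    intro E hE
    have := hmin.1 E hE
    simp only [IsTransversal, not_forall] at this
    obtain ⟨F, hF, h⟩ := this
    exact ⟨F, hF, Finset.disjoint_iff_inter_eq_empty.2 (Finset.not_nonempty_iff_eq_empty.1 h)⟩
  intro x
  induction x using WellFoundedLT.induction with
  | ind x ih =>
    rw [sg]
    refine mex_eq ?_ fun l hl => ?_
    · rintro ⟨y, hy, hxy⟩
      rw [ih y hy.1] at hxy
      exact jmFormula_ne_of_move h0 htf hy hxy.symm
    · suffices ∃ y, Move H x y ∧ jmFormula H y = l by
        obtain ⟨y, hy, hyl⟩ := this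
        exact ⟨y, hy, hyl.symm.trans (ih y hy.1).symm⟩
      rcases lt_or_ge l (minPile x) with hlm | hlm
      · exact exists_move_jmFormula_of_lt_minPile h0 hex hmin hH.covers hpiv hl hlm
      · have hlong : minPile x ≤ (yVal H x).choose 2 := by
          by_contra! h
          have := jmFormula_lt_minPile h
          omega
        rw [jmFormula_of_le hlong] at hl
        exact exists_move_jmFormula_of_minPile_le h0 hex hmin hadd hpiv hlong hl hlm

end

/-! ### The k-sets that avoid K -/

section

variable {V : Type*} {H K : Finset (Finset V)} {k δ : ℕ}

lemma not_subset_of_card_lt {r : ℕ} (hK : IsUniform r K) {W : Finset V} (hW : r < W.card) :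
    ∀ A ∈ K, ¬ W ⊆ A := fun A hA h => by
  have := Finset.card_le_card h
  rw [hK A hA] at this
  omega

variable [DecidableEq V]

lemma exists_mem_notMem (hK3 : ∀ v : V, ¬ IsTransversal K {v}) (v : V) : ∃ A ∈ K, v ∉ A := by
  have := hK3 v
  simp only [IsTransversal, not_forall] at this
  obtain ⟨A, hA, h⟩ := this
  refine ⟨A, hA, fun hv => h ⟨v, by simp [hv]⟩⟩

variable [Fintype V]

lemma mem_avoiding {E : Finset V} : E ∈ avoiding k K ↔ E.card = k ∧ ∀ A ∈ K, ¬ E ⊆ A := by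
  simp [avoiding, Finset.mem_powersetCard]

/-- A `(k - 1)`-set lies in at most one member of `K`. Hence it extends to a hyperedge by an element
of any set that is not contained in a member of `K`. -/
lemma exists_insert_mem_avoiding (hk : 2 ≤ k)
    (hK2 : ∀ A ∈ K, ∀ B ∈ K, A ≠ B → (A ∩ B).card ≤ k - 2) {D W : Finset V} (hD : D.card + 1 = k)
    (hWk : k ≤ W.card) (hW : ∀ A ∈ K, ¬ W ⊆ A) : ∃ b ∈ W \ D, insert b D ∈ avoiding k K := by
  by_contra! hcon
  have h : ∀ b ∈ W \ D, ∃ A ∈ K, insert b D ⊆ A := by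
    intro b hb
    by_contra! hA
    refine hcon b hb (mem_avoiding.2 ⟨?_, hA⟩)
    rw [Finset.card_insert_of_notMem (Finset.mem_sdiff.1 hb).2, hD]
  have hne : ¬ W ⊆ D := fun hs => by
    have := Finset.card_le_card hs
    omega
  obtain ⟨c, hc, hcD⟩ := Finset.not_subset.1 hne
  obtain ⟨A, hA, hcA⟩ := h c (Finset.mem_sdiff.2 ⟨hc, hcD⟩)
  have hDA : D ⊆ A := (Finset.subset_insert c D).trans hcA
  refine hW A hA fun b hb => ?_
  by_cases hbD : b ∈ D
  · exact hDA hbD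
  obtain ⟨B, hB, hbB⟩ := h b (Finset.mem_sdiff.2 ⟨hb, hbD⟩)
  have hAB : A = B := by
    by_contra hne
    have h1 := hK2 A hA B hB hne
    have h2 := Finset.card_le_card
      (Finset.subset_inter hDA ((Finset.subset_insert b D).trans hbB))
    omega
  exact hAB ▸ hbB (Finset.mem_insert_self b D)

lemma empty_notMem_avoiding (hk : 1 ≤ k) : ∅ ∉ avoiding k K := fun h => by
  have := (mem_avoiding.1 h).1
  simp at this
  omega

lemma exchange_avoiding (hk : 2 ≤ k)
    (hK2 : ∀ A ∈ K, ∀ B ∈ K, A ≠ B → (A ∩ B).card ≤ k - 2) : Exchange (avoiding k K) := by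
  intro E hE F hF a ha
  rw [mem_avoiding] at hE hF
  rw [Finset.mem_sdiff] at ha
  obtain ⟨b, hb, hbE⟩ := exists_insert_mem_avoiding (D := E.erase a) hk hK2
    (by rw [Finset.card_erase_add_one ha.1, hE.1]) hF.1.ge hF.2
  refine ⟨b, ?_, hbE⟩
  simp only [Finset.mem_sdiff, Finset.mem_erase, not_and] at hb ⊢
  exact ⟨hb.1, hb.2 fun h => ha.2 (h ▸ hb.1)⟩

lemma Exchange.isMatroidHypergraph (hex : Exchange H) (hne : H.Nonempty) :
    IsMatroidHypergraph H := by
  obtain ⟨E, hE⟩ := hne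
  refine ⟨Matroid.ofIsBaseOfFinite (E := Set.univ) Set.finite_univ
    (fun B => ∃ F ∈ H, (F : Set V) = B) ⟨E, E, hE, rfl⟩ ?_ (fun _ _ => Set.subset_univ _), rfl, ?_⟩
  · rintro _ _ ⟨E, hE, rfl⟩ ⟨F, hF, rfl⟩ a ha
    obtain ⟨b, hb, hEb⟩ := hex E hE F hF a (by simpa using ha)
    exact ⟨b, by simpa using hb, _, hEb, by simp⟩
  · intro B
    change (∃ F ∈ H, (F : Set V) = B) ↔ B ∈ H
    simp

lemma exists_avoiding_through (hk : 2 ≤ k)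
    (hK2 : ∀ A ∈ K, ∀ B ∈ K, A ≠ B → (A ∩ B).card ≤ k - 2) {W : Finset V} (hWk : k ≤ W.card)
    (hW : ∀ A ∈ K, ¬ W ⊆ A) (i : V) : ∃ F ∈ avoiding k K, i ∈ F ∧ F ⊆ insert i W := by
  have h1 : ({i} : Finset V) ⊆ insert i W := by simp
  have h2 : k ≤ (insert i W).card := hWk.trans (Finset.card_le_card (Finset.subset_insert i W))
  obtain ⟨D, hiD, hDW, hD⟩ := Finset.exists_subsuperset_card_eq h1 (n := k - 1)
    (by rw [Finset.card_singleton]; omega) (by omega)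
  obtain ⟨b, hb, hbD⟩ := exists_insert_mem_avoiding (D := D) hk hK2 (by omega) hWk hW
  refine ⟨_, hbD, Finset.mem_insert_of_mem (hiD (by simp)), Finset.insert_subset ?_ hDW⟩
  exact Finset.mem_insert_of_mem (Finset.mem_sdiff.1 hb).1

section

variable (hδ : 0 < δ) (hδk : δ + 3 ≤ k) (hV : Fintype.card V = 2 * k + δ)
  (hK : IsUniform (k + δ - 1) K) (hK1 : ∀ A ∈ K, ∀ B ∈ K, δ ≤ (A ∩ B).card)
  (hK2 : ∀ A ∈ K, ∀ B ∈ K, A ≠ B → (A ∩ B).card ≤ k - 2) (hK3 : ∀ v : V, ¬ IsTransversal K {v})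

include hδ hδk hV hK hK2 in
lemma isHypergraph_avoiding : IsHypergraph (avoiding k K) := by
  have hcov : ∀ v : V, ∃ E ∈ avoiding k K, v ∈ E := fun v => by
    obtain ⟨F, hF, hv, -⟩ := exists_avoiding_through (K := K) (k := k) (W := Finset.univ)
      (by omega) hK2 (by rw [Finset.card_univ]; omega)
      (not_subset_of_card_lt hK (by rw [Finset.card_univ]; omega)) v
    exact ⟨F, hF, hv⟩
  have : 0 < Fintype.card V := by omega
  obtain ⟨v⟩ := Fintype.card_pos_iff.1 this
  obtain ⟨E, hE, -⟩ := hcov v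
  exact ⟨⟨E, hE⟩, empty_notMem_avoiding (by omega), hcov⟩

include hδ hV hK hK1 in
-- A member B of K containing `E` would also contain the disjoint set A ∩ B, hence at least k + δ
-- points, one too many.
lemma mem_avoiding_of_disjoint {A E : Finset V} (hA : A ∈ K) (hE : E.card = k)
    (hd : Disjoint E A) : E ∈ avoiding k K := by
  refine mem_avoiding.2 ⟨hE, fun B hB hEB => ?_⟩
  have h1 := hK1 A hA B hB
  have hdis : Disjoint E (A ∩ B) := hd.mono_right Finset.inter_subset_left
  have h2 := Finset.card_le_card (Finset.union_subset hEB (Finset.inter_subset_right (s₁ := A)))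
  rw [Finset.card_union_of_disjoint hdis, hK B hB] at h2
  omega

include hδ hδk hV hK hK1 hK2 hK3 in
-- The pivot is the complement of A ∪ {i}, of size k, for some A ∈ K missing `i`. A hyperedge
-- disjoint from it lies in A ∪ {i} but not in A, so it contains `i`.
lemma exists_isPivot_avoiding (i : V) : ∃ E, IsPivot (avoiding k K) i E := by
  obtain ⟨A, hA, hiA⟩ := exists_mem_notMem hK3 i
  have hcard : (insert i A)ᶜ.card = k := by
    rw [Finset.card_compl, Finset.card_insert_of_notMem hiA, hK A hA]
    omega
  have hEA : Disjoint (insert i A)ᶜ A :=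
    disjoint_compl_left.mono_right (Finset.subset_insert i A)
  have hiE : i ∉ (insert i A)ᶜ := by simp
  refine ⟨(insert i A)ᶜ, by omega, mem_avoiding_of_disjoint hδ hV hK hK1 hA hcard hEA, hiE,
    ?_, ?_, ?_⟩
  · intro F hF hd
    by_contra hiF
    refine (mem_avoiding.1 hF).2 A hA fun j hj => ?_
    have := Finset.disjoint_left.1 hd hj
    rw [Finset.mem_compl, not_not] at this
    rcases Finset.mem_insert.1 this with rfl | h
    · exact absurd hj hiF
    · exact h
  · intro b hb
    refine mem_avoiding_of_disjoint hδ hV hK hK1 hA ?_ ?_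
    · rw [Finset.card_insert_of_notMem fun h => hiE (Finset.mem_of_mem_erase h),
        Finset.card_erase_add_one hb, hcard]
    · rw [Finset.disjoint_insert_left]
      exact ⟨hiA, hEA.mono_left (Finset.erase_subset _ _)⟩
  · intro b hb c hc hbc F hF hd
    -- These k - 1 points lie in `A` and hence in no other member of K; as `c ∉ A`, adding `c` gives
    -- a hyperedge.
    have hFA : F.erase b ⊆ A := by
      intro j hj
      rw [Finset.mem_erase] at hj
      have := Finset.disjoint_left.1 hd hj.2
      simp only [Finset.mem_insert, Finset.mem_erase, Finset.mem_compl, not_or, not_and] at this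
      exact by_contra fun hjA => this.2 hj.1 this.1 hjA
    obtain ⟨hFk, hFK⟩ := mem_avoiding.1 hF
    have hbF : b ∈ F := by
      by_contra hbF
      rw [Finset.erase_eq_of_notMem hbF] at hFA
      exact hFK A hA hFA
    have hcA : c ∉ A := Finset.disjoint_left.1 hEA hc
    have hFc := Finset.card_erase_add_one hbF
    refine ⟨hbF, mem_avoiding.2 ⟨?_, fun B hB hcB => ?_⟩⟩
    · rw [Finset.card_insert_of_notMem fun h => hcA (hFA h)]
      omega
    · have hne : A ≠ B := by
        rintro rfl
        exact hcA (hcB (Finset.mem_insert_self _ _))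
      have h1 := hK2 A hA B hB hne
      have h2 := Finset.card_le_card
        (Finset.subset_inter hFA ((Finset.subset_insert c _).trans hcB))
      omega

include hδ hδk hV hK hK1 hK2 hK3 in
-- The complement of a hyperedge has k + δ points, too many for a member of K, so it contains a
-- hyperedge. For minimality, let A ∈ K miss a point outside S: then S \ A has at most k points and
-- extends inside S to a hyperedge. Each hyperedge within S leaves A, so it meets S \ A.
lemma isMinimalTransversalFree_avoiding : IsMinimalTransversalFree (avoiding k K) := by
  constructor
  · intro E hE ht
    have hEk := (mem_avoiding.1 hE).1
    have hW : Eᶜ.card = k + δ := by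
      rw [Finset.card_compl]
      omega
    obtain ⟨D, hDE, hD⟩ := Finset.exists_subset_card_eq (s := Eᶜ) (n := k - 1) (by omega)
    obtain ⟨b, hb, hbD⟩ := exists_insert_mem_avoiding (K := K) (k := k) (D := D) (W := Eᶜ)
      (by omega) hK2 (by omega) (by omega) (not_subset_of_card_lt hK (by omega))
    obtain ⟨j, hj⟩ := ht _ hbD
    rw [Finset.mem_inter, Finset.mem_insert] at hj
    rcases hj.2 with rfl | hjD
    · exact Finset.mem_compl.1 (Finset.mem_sdiff.1 hb).1 hj.1
    · exact Finset.mem_compl.1 (hDE hjD) hj.1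
  · rintro S hS ⟨F, hF⟩ htf
    simp only [induced, Finset.mem_filter] at hF
    obtain ⟨i, hi⟩ : ∃ i, i ∉ S := by
      by_contra! h
      exact hS (Finset.eq_univ_iff_forall.2 h)
    obtain ⟨A, hA, hiA⟩ := exists_mem_notMem hK3 i
    obtain ⟨hFk, hFK⟩ := mem_avoiding.1 hF.1
    obtain ⟨E, hE, hES, hSE⟩ : ∃ E ∈ avoiding k K, E ⊆ S ∧ S \ A ⊆ E := by
      have hle : (S \ A).card ≤ k := by
        have h1 : S \ A ⊆ (insert i A)ᶜ := by
          intro j hj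
          rw [Finset.mem_sdiff] at hj
          simp only [Finset.mem_compl, Finset.mem_insert, not_or]
          exact ⟨fun h => hi (h ▸ hj.1), hj.2⟩
        have h2 := Finset.card_le_card h1
        rw [Finset.card_compl, Finset.card_insert_of_notMem hiA, hK A hA] at h2
        omega
      rcases hle.eq_or_lt with h | h
      · exact ⟨_, mem_avoiding_of_disjoint hδ hV hK hK1 hA h Finset.sdiff_disjoint,
          Finset.sdiff_subset, le_rfl⟩
      · have hkS : k ≤ S.card := hFk ▸ Finset.card_le_card hF.2
        obtain ⟨D, hAD, hDS, hD⟩ := Finset.exists_subsuperset_card_eq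
          (Finset.sdiff_subset : S \ A ⊆ S) (n := k - 1) (by omega) (by omega)
        obtain ⟨b, hb, hbD⟩ := exists_insert_mem_avoiding (K := K) (k := k) (D := D) (W := F)
          (by omega) hK2 (by omega) (by omega) hFK
        exact ⟨_, hbD, Finset.insert_subset (hF.2 (Finset.mem_sdiff.1 hb).1) hDS,
          hAD.trans (Finset.subset_insert b D)⟩
    refine htf E (by simp [induced, hE, hES]) fun T hT => ?_
    simp only [induced, Finset.mem_filter] at hT
    obtain ⟨j, hj, hjA⟩ := Finset.not_subset.1 ((mem_avoiding.1 hT.1).2 A hA)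
    exact ⟨j, Finset.mem_inter.2 ⟨hSE (Finset.mem_sdiff.2 ⟨hT.2 hj, hjA⟩), hj⟩⟩

end

end

end HypergraphNim

open HypergraphNim in
theorem mainTheorem10 {V : Type*} [Fintype V] [DecidableEq V] (k δ : ℕ)
    (hδ : 0 < δ) (hδk : δ + 3 ≤ k) (hV : Fintype.card V = 2 * k + δ)
    (K : Finset (Finset V)) (hK : IsUniform (k + δ - 1) K)
    (hK1 : ∀ A ∈ K, ∀ B ∈ K, δ ≤ (A ∩ B).card)
    (hK2 : ∀ A ∈ K, ∀ B ∈ K, A ≠ B → (A ∩ B).card ≤ k - 2)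
    (hK3 : ∀ v : V, ¬ IsTransversal K {v}) :
    IsHypergraph (avoiding k K) ∧ IsMatroidHypergraph (avoiding k K) ∧
      IsMinimalTransversalFree (avoiding k K) ∧ IsJM (avoiding k K) := by
  have hH := isHypergraph_avoiding hδ hδk hV hK hK2
  have hex := exchange_avoiding (K := K) (k := k) (by omega) hK2
  have hmin := isMinimalTransversalFree_avoiding hδ hδk hV hK hK1 hK2 hK3
  have : Nonempty V := Fintype.card_pos_iff.1 (by omega)
  refine ⟨hH, hex.isMatroidHypergraph hH.nonempty, hmin, isJM_of_isPivot hH hex hmin ?_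
    (exists_isPivot_avoiding hδ hδk hV hK hK1 hK2 hK3)⟩
  intro E hE i
  obtain ⟨hEk, hEK⟩ := mem_avoiding.1 hE
  exact exists_avoiding_through (by omega) hK2 hEk.ge hEK i
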